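/- An \emph{oriented graph} is a directed graph without directed cycles of length $1$ or $2$. To \emph{push} a vertex of an oriented graph is to reverse the direction of all arcs incident with it. An oriented graph is an \emph{oriented clique} if any two distinct non-adjacent vertices are joined by a directed path of length $2$ (in one of the two directions), and it is a \emph{push clique} if it is an oriented clique after pushing any set of vertices (including the empty set). An undirected simple graph is an \emph{underlying push clique} if it is the underlying graph of some push clique. Let $C_7$ be the cycle $a_0a_1a_2a_3a_4a_5a_6a_0$, and let $H_{10}$, $H_{11}$, $H_{12}$ be the graphs on $\{a_0,\dots,a_6\}$ obtained from $C_7$ by adding the following chords: \begin{itemize} \item $H_{10}$: $a_0a_3,\ a_0a_4,\ a_1a_5,\ a_0a_2,\ a_3a_5,\ a_1a_6$ (13 edges in all); \item $H_{11}$: $a_0a_3,\ a_1a_4,\ a_0a_2,\ a_2a_4,\ a_4a_6,\ a_0a_5$ (13 edges in all); \item $H_{12}$: $a_0a_3,\ a_0a_4,\ a_2a_5,\ a_4a_6,\ a_1a_6$ (12 edges in all). \end{itemize} \textbf{Lemma.} If $G$ is a planar underlying push clique with exactly $7$ vertices, then $G$ contains $H_{10}$, $H_{11}$ or $H_{12}$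 (up to isomorphism) as a spanning subgraph. -/

import Mathlib

namespace PushClique

/-- An oriented graph: a directed graph without directed cycles of length one or two. -/
structure OrientedGraph (V : Type*) where
  /-- `Arc u v` says that there is an arc from `u` to `v`. -/
  Arc : V → V → Prop
  asymm : ∀ u v, Arc u v → ¬ Arc v u

namespace OrientedGraph

variable {V : Type*}

/-- The underlying simple graph: forget the directions of the arcs. -/
def underlying (D : OrientedGraph V) : SimpleGraph V where
  Adj u v := D.Arc u v ∨ D.Arc v u
  symm := ⟨fun _ _ h => h.symm⟩
  loopless := ⟨fun u h => h.elim (fun h => D.asymm u u h h) (fun h => D.asymm u u h h)⟩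

/-- Push the vertices of `S`. Pushing one vertex reverses all arcs incident with it, so after
pushing every vertex of `S` once (in any order) exactly the arcs with one end in `S` and the other
end outside `S` are reversed. -/
def push (D : OrientedGraph V) (S : Set V) : OrientedGraph V where
  Arc u v := ((u ∈ S ↔ v ∈ S) ∧ D.Arc u v) ∨ (¬ (u ∈ S ↔ v ∈ S) ∧ D.Arc v u)
  asymm u v h h' := by
    have h1 := D.asymm u v
    have h2 := D.asymm v u
    tauto

/-- An oriented clique: any two distinct non-adjacent vertices are joined by a directed path
of length two, in one direction or the other. -/
def IsOrientedClique (D : OrientedGraph V) : Prop :=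
  ∀ u v, u ≠ v → ¬ D.underlying.Adj u v →
    ∃ w, (D.Arc u w ∧ D.Arc w v) ∨ (D.Arc v w ∧ D.Arc w u)

/-- A push clique: an oriented graph which is an oriented clique after pushing any set of
vertices (in particular the empty set, so it is itself an oriented clique). -/
def IsPushClique (D : OrientedGraph V) : Prop :=
  ∀ S : Set V, (D.push S).IsOrientedClique

end OrientedGraph

/-- `G` is an underlying push clique: it is the underlying graph of some push clique. -/
def IsUnderlyingPushClique {V : Type*} (G : SimpleGraph V) : Prop :=
  ∃ D : OrientedGraph V, D.underlying = G ∧ D.IsPushClique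

/-- A drawing of `G` in the Euclidean plane without crossings: distinct vertices are distinct
points, every edge is a simple arc between the points of its two ends, the interior of an edge
contains no vertex, and the interiors of two distinct edges are disjoint. -/
structure PlaneDrawing {V : Type*} (G : SimpleGraph V) where
  point : V → EuclideanSpace ℝ (Fin 2)
  point_injective : Function.Injective point
  arc : G.edgeSet → C(unitInterval, EuclideanSpace ℝ (Fin 2))
  arc_injective : ∀ e, Function.Injective (arc e)
  arc_ends : ∀ e, s(arc e 0, arc e 1) = Sym2.map point e
  arc_avoids_points : ∀ e, ∀ t ∈ Set.Ioo (0 : unitInterval) 1, ∀ v, arc e t ≠ point v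
  arcs_disjoint : ∀ e f, e ≠ f → ∀ s ∈ Set.Ioo (0 : unitInterval) 1,
    ∀ t ∈ Set.Ioo (0 : unitInterval) 1, arc e s ≠ arc f t

/-- A graph is planar if it can be drawn in the plane without crossings. -/
def IsPlanar {V : Type*} (G : SimpleGraph V) : Prop :=
  Nonempty (PlaneDrawing G)

/-- `G` has a spanning subgraph isomorphic to `H`: some bijection from the vertices of `H` onto
all vertices of `G` sends edges to edges. -/
def ContainsSpanning {W V : Type*} (H : SimpleGraph W) (G : SimpleGraph V) : Prop :=
  ∃ φ : W ≃ V, ∀ u v, H.Adj u v → G.Adj (φ u) (φ v)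

/-- The 7-cycle `0,1,…,6` with the chords `03, 04, 15, 02, 35, 16`. -/
def H10 : SimpleGraph (Fin 7) :=
  SimpleGraph.fromEdgeSet
    {s(0, 1), s(1, 2), s(2, 3), s(3, 4), s(4, 5), s(5, 6), s(6, 0),
      s(0, 3), s(0, 4), s(1, 5), s(0, 2), s(3, 5), s(1, 6)}

/-- The 7-cycle `0,1,…,6` with the chords `03, 14, 02, 24, 46, 05`. -/
def H11 : SimpleGraph (Fin 7) :=
  SimpleGraph.fromEdgeSet
    {s(0, 1), s(1, 2), s(2, 3), s(3, 4), s(4, 5), s(5, 6), s(6, 0),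
      s(0, 3), s(1, 4), s(0, 2), s(2, 4), s(4, 6), s(0, 5)}

/-- The 7-cycle `0,1,…,6` with the chords `03, 04, 25, 46, 16`. -/
def H12 : SimpleGraph (Fin 7) :=
  SimpleGraph.fromEdgeSet
    {s(0, 1), s(1, 2), s(2, 3), s(3, 4), s(4, 5), s(5, 6), s(6, 0),
      s(0, 3), s(0, 4), s(2, 5), s(4, 6), s(1, 6)}

end PushClique

/-!
A planar graph contains no subdivision of `K₃,₃`. On seven vertices such a subdivision is `K₃,₃`
itself or `K₃,₃` with one edge subdivided once (`IsPlanar.not_subdivided_K33`). No Jordan curve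
theorem is needed: if `γ` and `δ` are disjoint curves, then `(s, t) ↦ γ s - δ t` has a continuous
logarithm on the unit square, so the turns of `γ - δ 0`, `δ - γ 1`, `γ - δ 1` and `δ - γ 0` add up
to zero, with signs, around the boundary (`logIncr_square`). For a drawing of `K₃,₃`, each turn
of an edge around a vertex occurs in exactly two of the eighteen pairs of independent edges. Hence
the whole
turns cancel modulo two in the sum, while the half turns by which the two directions between two
vertices differ contribute an odd number (`not_exists_bipartite_curves`).

Pushing one of two non-adjacent vertices shows that in a push clique they have a common neighbour
through which a directed path passes and another one through which none passes
(`OrientedGraph.IsPushClique.common_neighbors`). So any two non-adjacent vertices have two common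
neighbours, and the minimum degree of a push clique on seven vertices is at least two.

* If some vertex `v` has degree two, then its neighbours `p` and `q` are adjacent to the four other
  vertices but, by the directions of the arcs, are useless for non-adjacent pairs of these. So
  these four vertices span a graph of diameter at most two, which with `p`, `q` and `v` gives a
  subdivision of `K₃,₃` (`containsSpanning_of_degree_two`).
* If the minimum degree is three or more, the directions no longer matter: every such graph on
  seven vertices in which non-adjacent vertices have two common neighbours contains `H10`, `H11`,
  `H12` or a subdivision of `K₃,₃`. This finite statement is checked by a search through all graphs
  in which the vertex `0` has the neighbours `1, 2, 3` only, or at least the neighbours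
  `1, 2, 3, 4` (`exists_of_search`, `search_placements3`, `search_placements4`).
-/

namespace PushClique

open Complex

/-! ### Increments of the logarithm along a path -/

theorem exists_log_lift {A : Type*} [TopologicalSpace A] [SimplyConnectedSpace A]
    [LocallyPathConnectedSpace A] [Inhabited A] {f : A → ℂ} (hf : Continuous f)
    (h0 : ∀ a, f a ≠ 0) : ∃ L : A → ℂ, Continuous L ∧ ∀ a, exp (L a) = f a := by
  obtain ⟨F, ⟨-, hF⟩, -⟩ := isCoveringMapOn_exp.existsUnique_continuousMap_lifts
    (⟨f, hf⟩ : C(A, ℂ)) (a₀ := default) (e₀ := log (f default)) (exp_log (h0 _)) h0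
  exact ⟨F, F.continuous, fun a => congrFun hF a⟩

open Classical in
/-- The increment `L 1 - L 0` of a continuous logarithm `L` of `f`, a curve in the plane that
avoids the origin; curves are parametrised by the whole real line, of which only `[0, 1]`
matters. The value is `0` if `f` has no continuous logarithm. -/
noncomputable def logIncr (f : ℝ → ℂ) : ℂ :=
  if h : ∃ L : ℝ → ℂ, Continuous L ∧ ∀ t, exp (L t) = f t then h.choose 1 - h.choose 0 else 0

/-- The increment does not depend on the logarithm, nor on a constant factor of the curve. -/
theorem sub_eq_logIncr {f L : ℝ → ℂ} {c : ℂ} (hf : Continuous f) (h0 : ∀ t, f t ≠ 0)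
    (hL : Continuous L) (h : ∀ t, exp (L t) = c * f t) : L 1 - L 0 = logIncr f := by
  have hex := exists_log_lift hf h0
  rw [logIncr, dif_pos hex]
  obtain ⟨hM, hMf⟩ := hex.choose_spec
  set M := hex.choose
  have key : (fun t => M t + (L 0 - M 0)) = L := by
    refine isCoveringMap_exp.eq_of_comp_eq (A := ℝ) (by fun_prop) hL ?_ 0 (by ring)
    funext t
    refine Subtype.ext ?_
    simp only [Function.comp_apply]
    rw [exp_add, exp_sub, h, h, hMf, hMf]
    field_simp [h0 0]
  have := congrFun key 1
  rw [← this]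
  ring

theorem exp_logIncr {f : ℝ → ℂ} (hf : Continuous f) (h0 : ∀ t, f t ≠ 0) :
    exp (logIncr f) = f 1 / f 0 := by
  obtain ⟨L, hL, hLf⟩ := exists_log_lift hf h0
  rw [← sub_eq_logIncr (c := 1) hf h0 hL (by simpa using hLf), exp_sub, hLf, hLf]

/-- For disjoint curves `γ` and `δ`, the map `(s, t) ↦ γ s - δ t` avoids the origin on the unit
square, so that its logarithm has no total increment around the boundary. -/
theorem logIncr_square {γ δ : ℝ → ℂ} (hγ : Continuous γ) (hδ : Continuous δ)
    (h : ∀ s t, γ s ≠ δ t) :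
    logIncr (fun s => γ s - δ 0) + logIncr (fun t => δ t - γ 1) =
      logIncr (fun t => δ t - γ 0) + logIncr (fun s => γ s - δ 1) := by
  obtain ⟨L, hL, hLf⟩ := exists_log_lift (A := ℝ × ℝ) (f := fun x => γ x.1 - δ x.2)
    (by fun_prop) (fun x => sub_ne_zero.2 (h _ _))
  have h1 : ∀ t, L (1, t) - L (0, t) = logIncr (fun s => γ s - δ t) := fun t =>
    sub_eq_logIncr (c := 1) (L := fun s => L (s, t)) (by fun_prop)
      (fun s => sub_ne_zero.2 (h _ _)) (by fun_prop) (fun s => by simp [hLf])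
  have h2 : ∀ s, L (s, 1) - L (s, 0) = logIncr (fun t => δ t - γ s) := fun s =>
    sub_eq_logIncr (c := -1) (L := fun t => L (s, t)) (by fun_prop)
      (fun t => sub_ne_zero.2 (h _ _).symm) (by fun_prop) (fun t => by simp [hLf])
  rw [← h1 0, ← h1 1, ← h2 0, ← h2 1]
  ring

/-! ### Subdivisions of `K₃,₃` are not planar -/

/-- Logarithms of the differences of finitely many distinct points, chosen so that reversing a
difference changes its logarithm by exactly `π * I`. -/
theorem exists_log_sub {n : ℕ} {p : Fin n → ℂ} (hp : ∀ i j, i ≠ j → p i ≠ p j) :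
    ∃ α : Fin n → Fin n → ℂ, (∀ i j, i ≠ j → exp (α i j) = p j - p i) ∧
      ∀ i j, i < j → α j i = α i j + Real.pi * I := by
  refine ⟨fun i j => if i < j then log (p j - p i) else log (p i - p j) + Real.pi * I,
    fun i j hij => ?_, fun i j hij => ?_⟩
  · beta_reduce
    split_ifs with h
    · exact exp_log (sub_ne_zero.2 (hp _ _ hij.symm))
    · rw [exp_add, exp_log (sub_ne_zero.2 (hp _ _ hij)), exp_pi_mul_I]
      ring
  · simp [hij, hij.not_gt]

/-- There are no curves joining three points to three points in the plane such that two curves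
without a common end are disjoint. This is the van Kampen obstruction: in the sum of the equations
`logIncr_square` over the eighteen pairs of such curves, the whole turns form an even number, but
the choice of logarithms in `exists_log_sub` makes that number odd. -/
theorem not_exists_bipartite_curves (p q : Fin 3 → ℂ) (γ : Fin 3 → Fin 3 → ℝ → ℂ)
    (hγ : ∀ i j, Continuous (γ i j)) (h0 : ∀ i j, γ i j 0 = p i) (h1 : ∀ i j, γ i j 1 = q j)
    (hd : ∀ i i' j j', i ≠ i' → j ≠ j' → ∀ s t, γ i j s ≠ γ i' j' t) : False := by
  have other : ∀ i : Fin 3, ∃ j, i ≠ j := by decide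
  have hp : ∀ i i', i ≠ i' → p i ≠ p i' := fun i i' hi => by
    rw [← h0 i 0, ← h0 i' 1]; exact hd _ _ _ _ hi (by decide) _ _
  have hq : ∀ j j', j ≠ j' → q j ≠ q j' := fun j j' hj => by
    rw [← h1 0 j, ← h1 1 j']; exact hd _ _ _ _ (by decide) hj _ _
  have hpq : ∀ i j, p i ≠ q j := fun i j => by
    obtain ⟨i', hi⟩ := other i
    obtain ⟨j', hj⟩ := other j
    rw [← h0 i j', ← h1 i' j]; exact hd _ _ _ _ hi hj.symm _ _
  have hγp : ∀ i i' j, i ≠ i' → ∀ t, γ i j t - p i' ≠ 0 := fun i i' j hi t => by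
    obtain ⟨j', hj⟩ := other j
    rw [sub_ne_zero, ← h0 i' j']; exact hd _ _ _ _ hi hj _ _
  have hγq : ∀ i j j', j ≠ j' → ∀ t, γ i j t - q j' ≠ 0 := fun i j j' hj t => by
    obtain ⟨i', hi⟩ := other i
    rw [sub_ne_zero, ← h1 i' j']; exact hd _ _ _ _ hi hj _ _
  obtain ⟨α, hα, hα'⟩ := exists_log_sub hp
  obtain ⟨β, hβ, hβ'⟩ := exists_log_sub hq
  obtain ⟨c, hc⟩ : ∃ c : Fin 3 → Fin 3 → ℂ, ∀ i j, exp (c i j) = q j - p i :=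
    ⟨fun i j => log (q j - p i), fun i j => exp_log (sub_ne_zero.2 (hpq _ _).symm)⟩
  -- The increment along a curve, seen from a point, is known from its ends up to whole turns.
  have hP : ∀ i i' j, ∃ n : ℤ, i ≠ i' →
      logIncr (fun t => γ i j t - p i') = c i' j - α i' i + n * (2 * Real.pi * I) := by
    intro i i' j
    by_cases hi : i = i'
    · exact ⟨0, fun h => absurd hi h⟩
    · obtain ⟨n, hn⟩ := exp_eq_exp_iff_exists_int.1
        (show exp (logIncr fun t => γ i j t - p i') = exp (c i' j - α i' i) by
          rw [exp_logIncr (by fun_prop) (hγp _ _ _ hi), exp_sub, hc,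
            hα _ _ (Ne.symm hi), h0, h1])
      exact ⟨n, fun _ => hn⟩
  have hQ : ∀ i j j', ∃ n : ℤ, j ≠ j' →
      logIncr (fun t => γ i j t - q j') =
        β j' j - c i j' - Real.pi * I + n * (2 * Real.pi * I) := by
    intro i j j'
    by_cases hj : j = j'
    · exact ⟨0, fun h => absurd hj h⟩
    · obtain ⟨n, hn⟩ := exp_eq_exp_iff_exists_int.1
        (show exp (logIncr fun t => γ i j t - q j') = exp (β j' j - c i j' - Real.pi * I) by
          rw [exp_logIncr (by fun_prop) (hγq _ _ _ hj), exp_sub, exp_sub, hc,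
            hβ _ _ (Ne.symm hj), h0, h1, exp_pi_mul_I, ← neg_sub (q j') (p i)]
          simp only [div_neg, div_one])
      exact ⟨n, fun _ => hn⟩
  choose m hm using hP
  choose n hn using hQ
  have hsq : ∀ i i' j j', i < i' → j ≠ j' →
      m i' i j' + n i j j' - m i i' j - n i' j' j = if j < j' then -1 else 0 := by
    intro i i' j j' hi hj
    have h := logIncr_square (hγ i j) (hγ i' j') (hd _ _ _ _ hi.ne hj)
    rw [h0, h0, h1, h1, hm _ _ _ hi.ne, hm _ _ _ hi.ne', hn _ _ _ hj, hn _ _ _ hj.symm,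
      hα' _ _ hi] at h
    have hpi : (2 * Real.pi * I : ℂ) ≠ 0 := two_pi_I_ne_zero
    split_ifs with hlt
    · rw [hβ' _ _ hlt] at h
      have : ((m i' i j' + n i j j' - m i i' j - n i' j' j : ℤ) : ℂ) * (2 * Real.pi * I) =
          ((-1 : ℤ) : ℂ) * (2 * Real.pi * I) := by
        push_cast; linear_combination -h
      exact_mod_cast mul_right_cancel₀ hpi this
    · rw [hβ' _ _ (lt_of_le_of_ne (not_lt.1 hlt) hj.symm)] at h
      have : ((m i' i j' + n i j j' - m i i' j - n i' j' j : ℤ) : ℂ) * (2 * Real.pi * I) =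
          ((0 : ℤ) : ℂ) * (2 * Real.pi * I) := by
        push_cast; linear_combination -h
      exact_mod_cast mul_right_cancel₀ hpi this
  -- Modulo two, each `m` and each `n` occurs twice in the sum of these equations.
  have e1 := hsq 0 1 0 1 (by decide) (by decide)
  have e2 := hsq 0 1 0 2 (by decide) (by decide)
  have e3 := hsq 0 1 1 0 (by decide) (by decide)
  have e4 := hsq 0 1 1 2 (by decide) (by decide)
  have e5 := hsq 0 1 2 0 (by decide) (by decide)
  have e6 := hsq 0 1 2 1 (by decide) (by decide)
  have f1 := hsq 0 2 0 1 (by decide) (by decide)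
  have f2 := hsq 0 2 0 2 (by decide) (by decide)
  have f3 := hsq 0 2 1 0 (by decide) (by decide)
  have f4 := hsq 0 2 1 2 (by decide) (by decide)
  have f5 := hsq 0 2 2 0 (by decide) (by decide)
  have f6 := hsq 0 2 2 1 (by decide) (by decide)
  have g1 := hsq 1 2 0 1 (by decide) (by decide)
  have g2 := hsq 1 2 0 2 (by decide) (by decide)
  have g3 := hsq 1 2 1 0 (by decide) (by decide)
  have g4 := hsq 1 2 1 2 (by decide) (by decide)
  have g5 := hsq 1 2 2 0 (by decide) (by decide)
  have g6 := hsq 1 2 2 1 (by decide) (by decide)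
  simp at e1 e2 e3 e4 e5 e6 f1 f2 f3 f4 f5 f6 g1 g2 g3 g4 g5 g6
  omega

namespace PlaneDrawing

variable {V : Type*} {G : SimpleGraph V}

/-- The part of the plane covered by the edges that have both ends in `S`. -/
def trace (d : PlaneDrawing G) (S : Set V) : Set (EuclideanSpace ℝ (Fin 2)) :=
  {x | ∃ e : G.edgeSet, (∀ v ∈ (e : Sym2 V), v ∈ S) ∧ x ∈ Set.range (d.arc e)}

theorem arc_mem_cases (d : PlaneDrawing G) (e : G.edgeSet) (t : unitInterval) :
    (∃ v ∈ (e : Sym2 V), d.arc e t = d.point v) ∨ t ∈ Set.Ioo (0 : unitInterval) 1 := by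
  have hmem : ∀ x ∈ s(d.arc e 0, d.arc e 1), ∃ v ∈ (e : Sym2 V), x = d.point v := by
    rw [d.arc_ends e]
    intro x hx
    obtain ⟨v, hv, rfl⟩ := Sym2.mem_map.1 hx
    exact ⟨v, hv, rfl⟩
  rcases eq_or_ne t 0 with rfl | h0
  · exact Or.inl (hmem _ (Sym2.mem_mk_left _ _))
  rcases eq_or_ne t 1 with rfl | h1
  · exact Or.inl (hmem _ (Sym2.mem_mk_right _ _))
  exact Or.inr ⟨unitInterval.pos_iff_ne_zero.2 h0, unitInterval.lt_one_iff_ne_one.2 h1⟩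

theorem disjoint_trace (d : PlaneDrawing G) {S T : Set V} (hST : Disjoint S T) :
    Disjoint (d.trace S) (d.trace T) := by
  rw [Set.disjoint_left]
  rintro x ⟨e, heS, s, rfl⟩ ⟨f, hfT, t, hft⟩
  have hef : e ≠ f := by
    rintro rfl
    have h := (e : Sym2 V).out_fst_mem
    exact Set.disjoint_left.1 hST (heS _ h) (hfT _ h)
  rcases d.arc_mem_cases e s with ⟨v, hv, hsv⟩ | hs <;>
    rcases d.arc_mem_cases f t with ⟨w, hw, htw⟩ | ht
  · have : v = w := d.point_injective (by rw [← hsv, ← htw, hft])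
    exact Set.disjoint_left.1 hST (heS _ hv) (this ▸ hfT _ hw)
  · exact d.arc_avoids_points f t ht v (by rw [hft, hsv])
  · exact d.arc_avoids_points e s hs w (by rw [← hft, htw])
  · exact d.arcs_disjoint e f hef s hs t ht hft.symm

theorem joinedIn_trace (d : PlaneDrawing G) {S : Set V} {u v : V} (h : G.Adj u v)
    (hu : u ∈ S) (hv : v ∈ S) : JoinedIn (d.trace S) (d.point u) (d.point v) := by
  have hS : ∀ w ∈ s(u, v), w ∈ S := by
    intro w hw
    rcases Sym2.mem_iff.1 hw with rfl | rfl <;> assumption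
  let e : G.edgeSet := ⟨s(u, v), h⟩
  have hj : JoinedIn (d.trace S) (d.arc e 0) (d.arc e 1) :=
    ⟨⟨d.arc e, rfl, rfl⟩, fun t => ⟨e, hS, t, rfl⟩⟩
  rcases Sym2.eq_iff.1 (d.arc_ends e) with ⟨h0, h1⟩ | ⟨h0, h1⟩
  · rwa [h0, h1] at hj
  · rw [h0, h1] at hj
    exact hj.symm

end PlaneDrawing

/-- A planar graph contains neither `K₃,₃` nor `K₃,₃` with one edge subdivided; on seven vertices
these are all the subdivisions of `K₃,₃`. -/
theorem IsPlanar.not_subdivided_K33 {V : Type*} {G : SimpleGraph V} (hG : IsPlanar G)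
    (a b : Fin 3 → V) (c : V) (ha : Function.Injective a) (hb : Function.Injective b)
    (hab : ∀ i j, a i ≠ b j) (hca : ∀ i, c ≠ a i) (hcb : ∀ j, c ≠ b j)
    (hadj : ∀ i j, (i, j) ≠ (0, 0) → G.Adj (a i) (b j))
    (hsub : G.Adj (a 0) (b 0) ∨ G.Adj (a 0) c ∧ G.Adj c (b 0)) : False := by
  obtain ⟨d⟩ := hG
  let S : Fin 3 → Fin 3 → Set V := fun i j => {v | v = a i ∨ v = b j ∨ (i = 0 ∧ j = 0) ∧ v = c}
  have hS : ∀ i i' j j', i ≠ i' → j ≠ j' → Disjoint (S i j) (S i' j') := by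
    intro i i' j j' hi hj
    have hi' := ha.ne hi
    have hj' := hb.ne hj
    rw [Set.disjoint_left]
    rintro v (rfl | rfl | ⟨⟨rfl, rfl⟩, rfl⟩) (h | h | ⟨⟨rfl, rfl⟩, h⟩)
    all_goals first | exact hi rfl | exact hi' h | exact hj' h | exact hab _ _ h |
      exact hab _ _ h.symm | exact hca _ h | exact hca _ h.symm | exact hcb _ h |
      exact hcb _ h.symm
  have hjoin : ∀ i j, JoinedIn (d.trace (S i j)) (d.point (a i)) (d.point (b j)) := by
    intro i j
    by_cases hij : (i, j) = (0, 0)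
    · obtain ⟨rfl, rfl⟩ := Prod.mk.inj hij
      rcases hsub with h | ⟨h, h'⟩
      · exact d.joinedIn_trace h (Or.inl rfl) (Or.inr (Or.inl rfl))
      · have hc : c ∈ S 0 0 := Or.inr (Or.inr ⟨⟨rfl, rfl⟩, rfl⟩)
        exact (d.joinedIn_trace h (Or.inl rfl) hc).trans
          (d.joinedIn_trace h' hc (Or.inr (Or.inl rfl)))
    · exact d.joinedIn_trace (hadj i j hij) (Or.inl rfl) (Or.inr (Or.inl rfl))
  choose γ hγ using hjoin
  let ψ := Complex.orthonormalBasisOneI.repr.symm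
  refine not_exists_bipartite_curves (fun i => ψ (d.point (a i))) (fun j => ψ (d.point (b j)))
    (fun i j t => ψ ((γ i j).extend t)) (fun i j => by fun_prop) (fun i j => by simp)
    (fun i j => by simp) (fun i i' j j' hi hj s t hst => ?_)
  exact Set.disjoint_left.1 (d.disjoint_trace (hS i i' j j' hi hj)) (hγ i j _)
    (ψ.injective hst ▸ hγ i' j' _)

/-! ### Exhausting the graphs on seven vertices -/

/-- The set of the two ordered pairs `(i, j)` and `(j, i)`, where a set of ordered pairs of
elements of `Fin 7` is encoded as the natural number whose bit `7 * i + j` stands for `(i, j)`. -/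
def pairMask (i j : Fin 7) : ℕ := 2 ^ (7 * i + j : ℕ) ||| 2 ^ (7 * j + i : ℕ)

/-- The graph with the edges `es`, as a set of ordered pairs. -/
def edgeMask (es : List (Fin 7 × Fin 7)) : ℕ :=
  es.foldr (fun e m => pairMask e.1 e.2 ||| m) 0

/-- How many `x` are not excluded from being a common neighbour of `v` and `w` by the set `N` of
non-adjacent pairs. -/
def commonBound (N : ℕ) (v w : Fin 7) : ℕ :=
  ((List.finRange 7).filter fun x : Fin 7 =>
    !((N >>> (7 * v : ℕ) ||| N >>> (7 * w : ℕ)).testBit x)).length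

/-- The non-adjacent pairs in `N` leave less than `k` neighbours to `v`, or less than two common
neighbours to `v` and a vertex known to be non-adjacent to `v`. -/
def violates (k N : ℕ) (v : Fin 7) : Bool :=
  commonBound N v v < k || (List.finRange 7).any fun w : Fin 7 =>
    w != v && N.testBit (7 * v + w) && commonBound N v w < 2

/-- A search through all graphs on `Fin 7` with minimum degree at least `k` in which non-adjacent
vertices have two common neighbours, where the pairs in `E` are adjacent, those in `N` are not,
and those in the list are yet to be decided. The result is `true` if the search finds that all
of these graphs contain a member of `ms`; members that meet `N` are discarded on the way. -/
def search (k : ℕ) : List (Fin 7 × Fin 7) → List ℕ → ℕ → ℕ → Bool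
  | [], ms, E, _ => ms.any fun m => m &&& E == m
  | (i, j) :: l, ms, E, N =>
    (ms.any fun m => m &&& E == m) ||
      (search k l ms (E ||| pairMask i j) N &&
        (violates k (N ||| pairMask i j) i || violates k (N ||| pairMask i j) j ||
          search k l (ms.filter fun m => m &&& pairMask i j == 0) E (N ||| pairMask i j)))

/-- The pairs in `E` are adjacent in `G`, and those in `N` are not. -/
structure Fits (G : SimpleGraph (Fin 7)) (E N : ℕ) : Prop where
  adj : ∀ i j : Fin 7, E.testBit (7 * i + j) → G.Adj i j
  not_adj : ∀ i j : Fin 7, N.testBit (7 * i + j) → ¬ G.Adj i j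

theorem testBit_pairMask {i j a b : Fin 7} :
    (pairMask i j).testBit (7 * a + b) ↔ a = i ∧ b = j ∨ a = j ∧ b = i := by
  simp only [pairMask, Nat.testBit_or, Nat.testBit_two_pow, Bool.or_eq_true, decide_eq_true_eq]
  omega

theorem testBit_edgeMask {es : List (Fin 7 × Fin 7)} {a b : Fin 7} (h : (a, b) ∈ es) :
    (edgeMask es).testBit (7 * a + b) := by
  induction es with
  | nil => simp at h
  | cons e es ih =>
    rw [edgeMask, List.foldr_cons, Nat.testBit_or, Bool.or_eq_true]
    rcases List.mem_cons.1 h with rfl | h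
    · exact Or.inl (testBit_pairMask.2 (Or.inl ⟨rfl, rfl⟩))
    · exact Or.inr (ih h)

namespace Fits

variable {G : SimpleGraph (Fin 7)} {E N : ℕ} {i j : Fin 7}

theorem insert_adj (h : Fits G E N) (hij : G.Adj i j) : Fits G (E ||| pairMask i j) N := by
  refine ⟨fun a b hab => ?_, h.not_adj⟩
  rw [Nat.testBit_or, Bool.or_eq_true, testBit_pairMask] at hab
  rcases hab with hab | ⟨rfl, rfl⟩ | ⟨rfl, rfl⟩
  exacts [h.adj _ _ hab, hij, hij.symm]

theorem insert_not_adj (h : Fits G E N) (hij : ¬ G.Adj i j) :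
    Fits G E (N ||| pairMask i j) := by
  refine ⟨h.adj, fun a b hab => ?_⟩
  rw [Nat.testBit_or, Bool.or_eq_true, testBit_pairMask] at hab
  rcases hab with hab | ⟨rfl, rfl⟩ | ⟨rfl, rfl⟩
  exacts [h.not_adj _ _ hab, hij, fun h => hij h.symm]

theorem card_le_commonBound (h : Fits G E N) {v w : Fin 7} {s : Finset (Fin 7)}
    (hs : ∀ x ∈ s, G.Adj v x ∧ G.Adj w x) : s.card ≤ commonBound N v w := by
  rw [commonBound]
  refine le_trans (Finset.card_le_card fun x hx => ?_) (List.toFinset_card_le _)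
  rw [List.mem_toFinset, List.mem_filter]
  refine ⟨List.mem_finRange x, ?_⟩
  have h1 := mt (h.not_adj v x) (not_not.2 (hs x hx).1)
  have h2 := mt (h.not_adj w x) (not_not.2 (hs x hx).2)
  simp [Nat.testBit_or, Nat.testBit_shiftRight, h1, h2]

theorem violates_eq_false (h : Fits G E N) {k : ℕ}
    (hk : ∀ v, ∃ s : Finset (Fin 7), k ≤ s.card ∧ ∀ x ∈ s, G.Adj v x)
    (hc : ∀ v w, v ≠ w → ¬ G.Adj v w →
      ∃ x y, x ≠ y ∧ (G.Adj v x ∧ G.Adj w x) ∧ (G.Adj v y ∧ G.Adj w y)) (v : Fin 7) :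
    violates k N v = false := by
  rw [Bool.eq_false_iff]
  intro hv
  simp only [violates, Bool.or_eq_true, decide_eq_true_eq, List.any_eq_true, Bool.and_eq_true,
    bne_iff_ne] at hv
  rcases hv with hv | ⟨w, -, ⟨hwv, hN⟩, hlt⟩
  · obtain ⟨s, hs, hadj⟩ := hk v
    exact absurd (h.card_le_commonBound fun x hx => ⟨hadj x hx, hadj x hx⟩) (by omega)
  · obtain ⟨x, y, hxy, hx, hy⟩ := hc v w hwv.symm (h.not_adj _ _ hN)
    have := h.card_le_commonBound (s := {x, y}) (by
      intro z hz
      rcases Finset.mem_insert.1 hz with rfl | hz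
      · exact hx
      · exact Finset.mem_singleton.1 hz ▸ hy)
    rw [Finset.card_pair hxy] at this
    omega

end Fits

theorem exists_of_any_subset {G : SimpleGraph (Fin 7)} {E N : ℕ} {ms : List ℕ} (h : Fits G E N)
    (hms : (ms.any fun m => m &&& E == m) = true) :
    ∃ m ∈ ms, ∀ i j : Fin 7, m.testBit (7 * i + j) → G.Adj i j := by
  obtain ⟨m, hm, hE⟩ := List.any_eq_true.1 hms
  refine ⟨m, hm, fun i j hij => h.adj i j ?_⟩
  rw [← beq_iff_eq.1 hE, Nat.testBit_and, Bool.and_eq_true] at hij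
  exact hij.2

/-- Soundness of `search`: the two facts on degrees and common neighbours are what makes it
legitimate to abandon a branch on account of `violates`. -/
theorem exists_of_search {G : SimpleGraph (Fin 7)} {k : ℕ}
    (hk : ∀ v, ∃ s : Finset (Fin 7), k ≤ s.card ∧ ∀ x ∈ s, G.Adj v x)
    (hc : ∀ v w, v ≠ w → ¬ G.Adj v w →
      ∃ x y, x ≠ y ∧ (G.Adj v x ∧ G.Adj w x) ∧ (G.Adj v y ∧ G.Adj w y))
    {l : List (Fin 7 × Fin 7)} {ms : List ℕ} {E N : ℕ} (h : Fits G E N)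
    (hs : search k l ms E N = true) :
    ∃ m ∈ ms, ∀ i j : Fin 7, m.testBit (7 * i + j) → G.Adj i j := by
  induction l generalizing ms E N with
  | nil => exact exists_of_any_subset h hs
  | cons e l ih =>
    obtain ⟨i, j⟩ := e
    rw [search, Bool.or_eq_true, Bool.and_eq_true] at hs
    rcases hs with hs | ⟨hyes, hno⟩
    · exact exists_of_any_subset h hs
    by_cases hij : G.Adj i j
    · exact ih (h.insert_adj hij) hyes
    · have h' := h.insert_not_adj hij
      rw [h'.violates_eq_false hk hc, h'.violates_eq_false hk hc] at hno
      obtain ⟨m, hm, hG⟩ := ih h' hno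
      exact ⟨m, List.mem_of_mem_filter hm, hG⟩

/-! ### The graphs that are found -/

/-- The edges of `H10`. -/
def edges10 : List (Fin 7 × Fin 7) :=
  [(0, 1), (1, 2), (2, 3), (3, 4), (4, 5), (5, 6), (6, 0),
    (0, 3), (0, 4), (1, 5), (0, 2), (3, 5), (1, 6)]

/-- The edges of `H11`. -/
def edges11 : List (Fin 7 × Fin 7) :=
  [(0, 1), (1, 2), (2, 3), (3, 4), (4, 5), (5, 6), (6, 0),
    (0, 3), (1, 4), (0, 2), (2, 4), (4, 6), (0, 5)]

/-- The edges of `H12`. -/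
def edges12 : List (Fin 7 × Fin 7) :=
  [(0, 1), (1, 2), (2, 3), (3, 4), (4, 5), (5, 6), (6, 0),
    (0, 3), (0, 4), (2, 5), (4, 6), (1, 6)]

/-- The edges of `K₃,₃` with the parts `0, 1, 2` and `3, 4, 5`, except `03`. -/
def edgesK33 : List (Fin 7 × Fin 7) :=
  [(0, 4), (0, 5), (1, 3), (1, 4), (1, 5), (2, 3), (2, 4), (2, 5)]

/-- The edge lists of the graphs that are searched for: `H10`, `H11`, `H12`, and then `K₃,₃` and
`K₃,₃` with the edge `03` subdivided by `6`, which occur in no planar graph. -/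
def patterns : List (List (Fin 7 × Fin 7)) :=
  [edges10, edges11, edges12, (0, 3) :: edgesK33, (0, 6) :: (6, 3) :: edgesK33]

theorem H10_adj (u v : Fin 7) (h : H10.Adj u v) : (u, v) ∈ edges10 ∨ (v, u) ∈ edges10 := by
  rw [H10, SimpleGraph.fromEdgeSet_adj] at h
  simp only [Set.mem_insert_iff, Set.mem_singleton_iff, Sym2.eq_iff] at h
  casesm* _ ∧ _, _ ∨ _ <;> subst_vars <;> decide

theorem H11_adj (u v : Fin 7) (h : H11.Adj u v) : (u, v) ∈ edges11 ∨ (v, u) ∈ edges11 := by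
  rw [H11, SimpleGraph.fromEdgeSet_adj] at h
  simp only [Set.mem_insert_iff, Set.mem_singleton_iff, Sym2.eq_iff] at h
  casesm* _ ∧ _, _ ∨ _ <;> subst_vars <;> decide

theorem H12_adj (u v : Fin 7) (h : H12.Adj u v) : (u, v) ∈ edges12 ∨ (v, u) ∈ edges12 := by
  rw [H12, SimpleGraph.fromEdgeSet_adj] at h
  simp only [Set.mem_insert_iff, Set.mem_singleton_iff, Sym2.eq_iff] at h
  casesm* _ ∧ _, _ ∨ _ <;> subst_vars <;> decide

theorem containsSpanning_of_edges {V : Type*} [Fintype V] {G : SimpleGraph V}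
    (hcard : Fintype.card V = 7) {H : SimpleGraph (Fin 7)} {es : List (Fin 7 × Fin 7)}
    (hH : ∀ u v, H.Adj u v → (u, v) ∈ es ∨ (v, u) ∈ es) {f : Fin 7 → V}
    (hf : Function.Injective f) (hes : ∀ e ∈ es, G.Adj (f e.1) (f e.2)) :
    ContainsSpanning H G := by
  refine ⟨Equiv.ofBijective f ((Fintype.bijective_iff_injective_and_card f).2
    ⟨hf, by simp [hcard]⟩), fun u v huv => ?_⟩
  rcases hH u v huv with h | h
  exacts [hes _ h, (hes _ h).symm]

theorem containsSpanning_of_pattern {V : Type*} [Fintype V] {G : SimpleGraph V}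
    (hplanar : IsPlanar G) (hcard : Fintype.card V = 7) {es : List (Fin 7 × Fin 7)}
    (hpat : es ∈ patterns) {f : Fin 7 → V} (hf : Function.Injective f)
    (hes : ∀ e ∈ es, G.Adj (f e.1) (f e.2)) :
    ContainsSpanning H10 G ∨ ContainsSpanning H11 G ∨ ContainsSpanning H12 G := by
  have noK33 : (∀ e ∈ edgesK33, G.Adj (f e.1) (f e.2)) →
      (G.Adj (f 0) (f 3) ∨ G.Adj (f 0) (f 6) ∧ G.Adj (f 6) (f 3)) → False := by
    intro h
    refine hplanar.not_subdivided_K33 (fun i => f (![0, 1, 2] i)) (fun j => f (![3, 4, 5] j))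
      (f 6) (hf.comp (by decide)) (hf.comp (by decide)) (fun i j => hf.ne ?_)
      (fun i => hf.ne ?_) (fun j => hf.ne ?_) (fun i j hij => h (![0, 1, 2] i, ![3, 4, 5] j) ?_)
    · revert i j; decide
    · revert i; decide
    · revert j; decide
    · revert i j; decide
  simp only [patterns, List.mem_cons, List.not_mem_nil, or_false] at hpat
  rcases hpat with rfl | rfl | rfl | rfl | rfl
  · exact Or.inl (containsSpanning_of_edges hcard H10_adj hf hes)
  · exact Or.inr (Or.inl (containsSpanning_of_edges hcard H11_adj hf hes))
  · exact Or.inr (Or.inr (containsSpanning_of_edges hcard H12_adj hf hes))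
  · simp only [List.forall_mem_cons] at hes
    exact (noK33 hes.2 (Or.inl hes.1)).elim
  · simp only [List.forall_mem_cons] at hes
    exact (noK33 hes.2.2 (Or.inr ⟨hes.1, hes.2.1⟩)).elim

/-- The permutations of `Fin 7` that fix `0` and preserve each of the blocks `s` and `t`, as maps.
The blocks are the intervals of the remaining vertices, in increasing order. -/
def blockMaps (s t : List (Fin 7)) : List (Fin 7 → Fin 7) :=
  s.permutations'.flatMap fun l => t.permutations'.map fun l' => fun i => (0 :: l ++ l').getD i 0

/-- Some placements of the patterns on `Fin 7`, closed under permutations of `1, 2, 3` and of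
`4, 5, 6`. They suffice if `0` has the neighbours `1, 2, 3` only and all degrees are at least
three. -/
def placements3 : List (List (Fin 7 × Fin 7) × (Fin 7 → Fin 7)) :=
  (blockMaps [1, 2, 3] [4, 5, 6]).flatMap fun g =>
    [((0, 3) :: edgesK33, g ∘ ![0, 4, 5, 1, 2, 3, 6]),
      ((0, 6) :: (6, 3) :: edgesK33, g ∘ ![0, 5, 6, 4, 1, 2, 3]),
      ((0, 6) :: (6, 3) :: edgesK33, g ∘ ![1, 2, 3, 4, 0, 6, 5]),
      (edges10, g ∘ ![1, 2, 0, 3, 5, 4, 6]),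
      (edges10, g ∘ ![1, 3, 5, 4, 6, 2, 0]),
      (edges11, g ∘ ![1, 5, 4, 6, 2, 0, 3]),
      (edges11, g ∘ ![1, 0, 3, 6, 2, 4, 5]),
      (edges12, g ∘ ![2, 0, 1, 6, 4, 5, 3]),
      (edges12, g ∘ ![4, 2, 0, 3, 5, 1, 6])]

/-- Some placements of the patterns on `Fin 7`, closed under permutations of `1, 2, 3, 4` and of
`5, 6`. They suffice if `0` has at least the neighbours `1, 2, 3, 4` and all degrees are at least
four. -/
def placements4 : List (List (Fin 7 × Fin 7) × (Fin 7 → Fin 7)) :=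
  (blockMaps [1, 2, 3, 4] [5, 6]).flatMap fun g =>
    [((0, 3) :: edgesK33, g ∘ ![0, 5, 6, 1, 2, 3, 4]),
      ((0, 3) :: edgesK33, g ∘ ![0, 1, 2, 3, 4, 5, 6]),
      ((0, 6) :: (6, 3) :: edgesK33, g ∘ ![1, 3, 4, 2, 0, 5, 6]),
      ((0, 6) :: (6, 3) :: edgesK33, g ∘ ![1, 0, 5, 2, 3, 6, 4]),
      (edges12, g ∘ ![0, 3, 5, 4, 1, 6, 2])]

/-- The graph that a placement `(es, f)` yields, as a set of ordered pairs. -/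
def placedMask (t : List (Fin 7 × Fin 7) × (Fin 7 → Fin 7)) : ℕ :=
  edgeMask (t.1.map (Prod.map t.2 t.2))

theorem placements3_valid : ∀ t ∈ placements3, t.1 ∈ patterns ∧ Function.Injective t.2 := by
  decide +kernel

theorem placements4_valid : ∀ t ∈ placements4, t.1 ∈ patterns ∧ Function.Injective t.2 := by
  decide +kernel

/-- The set of non-adjacent pairs contains the diagonal, so that no vertex counts as its own
neighbour. -/
theorem search_placements3 :
    search 3 [(4, 1), (4, 2), (4, 3), (5, 1), (5, 2), (5, 3), (6, 1), (6, 2), (6, 3),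
        (4, 5), (4, 6), (5, 6), (1, 2), (1, 3), (2, 3)]
      (placements3.map placedMask) (edgeMask [(0, 1), (0, 2), (0, 3)])
      (edgeMask ([(0, 4), (0, 5), (0, 6)] ++ (List.finRange 7).map fun i => (i, i))) = true := by
  decide +kernel

theorem search_placements4 :
    search 4 [(5, 6), (0, 5), (0, 6), (5, 1), (5, 2), (5, 3), (5, 4), (6, 1), (6, 2), (6, 3),
        (6, 4), (1, 2), (1, 3), (1, 4), (2, 3), (2, 4), (3, 4)]
      (placements4.map placedMask) (edgeMask [(0, 1), (0, 2), (0, 3), (0, 4)])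
      (edgeMask ((List.finRange 7).map fun i => (i, i))) = true := by
  decide +kernel

/-! ### Push cliques -/

namespace OrientedGraph

variable {V : Type*} {D : OrientedGraph V}

/-- Pushing one of two non-adjacent vertices exchanges the directed paths of length two between
them with the pairs of arcs towards, or away from, a common neighbour. Hence both kinds of common
neighbours occur in a push clique. -/
theorem IsPushClique.common_neighbors (hD : D.IsPushClique) {u v : V} (huv : u ≠ v)
    (hadj : ¬ D.underlying.Adj u v) :
    (∃ w, (D.Arc u w ∧ D.Arc w v) ∨ (D.Arc v w ∧ D.Arc w u)) ∧
      ∃ w, (D.Arc u w ∧ D.Arc v w) ∨ (D.Arc w u ∧ D.Arc w v) := by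
  have push_adj : ∀ S, ¬ (D.push S).underlying.Adj u v := by
    intro S h
    apply hadj
    simp only [underlying, push] at h ⊢
    tauto
  constructor
  · obtain ⟨w, hw⟩ := hD ∅ u v huv (push_adj _)
    refine ⟨w, ?_⟩
    simpa [push] using hw
  · obtain ⟨w, hw⟩ := hD {u} u v huv (push_adj _)
    have hwu : w ≠ u := by
      rintro rfl
      have := (D.push {w}).asymm w w
      tauto
    refine ⟨w, ?_⟩
    simp only [push, Set.mem_singleton_iff, hwu, huv.symm, iff_false, not_true_eq_false,
      false_and, not_false_eq_true, true_and, or_false, false_or] at hw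
    tauto

theorem IsPushClique.exists_two_common (hD : D.IsPushClique) {u v : V} (huv : u ≠ v)
    (hadj : ¬ D.underlying.Adj u v) :
    ∃ x y, x ≠ y ∧ (D.underlying.Adj u x ∧ D.underlying.Adj v x) ∧
      (D.underlying.Adj u y ∧ D.underlying.Adj v y) := by
  obtain ⟨⟨x, hx⟩, ⟨y, hy⟩⟩ := hD.common_neighbors huv hadj
  refine ⟨x, y, ?_, ?_, ?_⟩
  · rintro rfl
    have h1 := D.asymm u x
    have h2 := D.asymm v x
    tauto
  · simp only [underlying]; tauto
  · simp only [underlying]; tauto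

/-- If `v` has only the two neighbours `p` and `q`, then all vertices `x` that are not adjacent to
`v` are adjacent to `p` and `q`, and the arcs between `x` and `p`, `q` fit together in the way
opposite to those at `v`. -/
theorem IsPushClique.arc_iff_of_two_neighbors (hD : D.IsPushClique) {v p q x : V}
    (hp : D.underlying.Adj v p) (hq : D.underlying.Adj v q)
    (hv : ∀ w, D.underlying.Adj v w → w = p ∨ w = q) (hx : x ≠ v)
    (hvx : ¬ D.underlying.Adj v x) :
    D.underlying.Adj p x ∧ D.underlying.Adj q x ∧
      ((D.Arc p x ↔ D.Arc q x) ↔ ¬ (D.Arc p v ↔ D.Arc q v)) := by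
  obtain ⟨⟨y, hy⟩, ⟨z, hz⟩⟩ := hD.common_neighbors hx.symm hvx
  have h1 := D.asymm p x
  have h2 := D.asymm q x
  have h3 := D.asymm p v
  have h4 := D.asymm q v
  have hy' := hv y (by simp only [underlying]; tauto)
  have hz' := hv z (by simp only [underlying]; tauto)
  simp only [underlying] at hp hq ⊢
  clear hv hvx
  rcases hy' with rfl | rfl <;> rcases hz' with rfl | rfl <;> grind

/-- If the arcs between `x` and `p`, `q` fit together in the same way as those between `y` and
`p`, `q`, then `p` and `q` are of the same kind as common neighbours of `x` and `y`. -/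
theorem not_mixed_of_arc_iff {p q x y w z : V}
    (hpx : D.underlying.Adj p x) (hqx : D.underlying.Adj q x) (hpy : D.underlying.Adj p y)
    (hqy : D.underlying.Adj q y) (h : (D.Arc p x ↔ D.Arc q x) ↔ (D.Arc p y ↔ D.Arc q y))
    (hw : w = p ∨ w = q) (hz : z = p ∨ z = q)
    (hwxy : (D.Arc x w ∧ D.Arc w y) ∨ (D.Arc y w ∧ D.Arc w x)) :
    ¬ ((D.Arc x z ∧ D.Arc y z) ∨ (D.Arc z x ∧ D.Arc z y)) := by
  have h1 := D.asymm p x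
  have h2 := D.asymm q x
  have h3 := D.asymm p y
  have h4 := D.asymm q y
  simp only [underlying] at hpx hqx hpy hqy
  rcases hw with rfl | rfl <;> rcases hz with rfl | rfl <;> grind

end OrientedGraph

/-- Vertices can be labelled by `Fin 7` with a given vertex `v` first, followed by those of a given
set `s`. -/
theorem exists_labelling {V : Type*} [Fintype V] (hcard : Fintype.card V = 7) {v : V}
    {s : Finset V} (hv : v ∉ s) :
    ∃ e : Fin 7 ≃ V, e 0 = v ∧ ∀ i, e i ∈ s ↔ 1 ≤ (i : ℕ) ∧ (i : ℕ) ≤ s.card := by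
  classical
  have hs : s.card ≤ 6 := by
    have := Finset.card_le_univ (insert v s)
    rw [Finset.card_insert_of_notMem hv, hcard] at this
    omega
  let e₀ : Fin 7 ≃ V := Fintype.equivOfCardEq (by simp [hcard])
  have hc : Fintype.card {i : Fin 7 // 1 ≤ (i : ℕ) ∧ (i : ℕ) ≤ s.card} =
      Fintype.card {i : Fin 7 // e₀ i ∈ s} := by
    have h : Fintype.card {i : Fin 7 // e₀ i ∈ s} = s.card := by
      rw [Fintype.card_congr (e₀.subtypeEquiv (q := fun x => x ∈ s) fun _ => Iff.rfl),
        Fintype.card_coe]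
    rw [h]
    generalize s.card = n at hs
    interval_cases n <;> rfl
  let σ := (Fintype.equivOfCardEq hc).extendSubtype
  have hσ : ∀ i : Fin 7, e₀ (σ i) ∈ s ↔ 1 ≤ (i : ℕ) ∧ (i : ℕ) ≤ s.card := fun i =>
    ⟨fun h => by_contra fun hi => (Fintype.equivOfCardEq hc).extendSubtype_not_mem i hi h,
      (Fintype.equivOfCardEq hc).extendSubtype_mem i⟩
  -- Both `v` and the vertex that is labelled `0` so far lie outside `s`.
  refine ⟨(σ.trans e₀).trans (Equiv.swap (e₀ (σ 0)) v), by simp, fun i => ?_⟩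
  have h0 : e₀ (σ 0) ∉ s := by simp [hσ]
  rw [← hσ, Equiv.trans_apply, Equiv.trans_apply, Equiv.swap_apply_def]
  split_ifs with h1 h2
  · rw [h1]; exact iff_of_false hv h0
  · rw [h2]; exact iff_of_false h0 hv
  · rfl

variable {V : Type*} [Fintype V]

theorem containsSpanning_of_search {G : SimpleGraph V} [DecidableRel G.Adj] (hplanar : IsPlanar G)
    (hcard : Fintype.card V = 7) (e : Fin 7 ≃ V) {k : ℕ} (hk : ∀ v, k ≤ G.degree v)
    (hc : ∀ u v, u ≠ v → ¬ G.Adj u v →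
      ∃ x y, x ≠ y ∧ (G.Adj u x ∧ G.Adj v x) ∧ (G.Adj u y ∧ G.Adj v y))
    {l : List (Fin 7 × Fin 7)} {ps : List (List (Fin 7 × Fin 7) × (Fin 7 → Fin 7))} {E N : ℕ}
    (hps : ∀ t ∈ ps, t.1 ∈ patterns ∧ Function.Injective t.2) (h : Fits (G.comap e) E N)
    (hs : search k l (ps.map placedMask) E N = true) :
    ContainsSpanning H10 G ∨ ContainsSpanning H11 G ∨ ContainsSpanning H12 G := by
  have hk' : ∀ i, ∃ s : Finset (Fin 7), k ≤ s.card ∧ ∀ x ∈ s, (G.comap e).Adj i x := by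
    refine fun i => ⟨(G.neighborFinset (e i)).map e.symm.toEmbedding, ?_, fun x hx => ?_⟩
    · rw [Finset.card_map]; exact hk _
    · obtain ⟨y, hy, rfl⟩ := Finset.mem_map.1 hx
      simpa using hy
  obtain ⟨m, hm, hG⟩ := exists_of_search hk' (fun i j hij hadj => by
    obtain ⟨x, y, hxy, hx, hy⟩ := hc (e i) (e j) (e.injective.ne hij) hadj
    exact ⟨e.symm x, e.symm y, e.symm.injective.ne hxy, by simpa using hx, by simpa using hy⟩) h hs
  obtain ⟨⟨es, f⟩, ht, rfl⟩ := List.mem_map.1 hm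
  refine containsSpanning_of_pattern hplanar hcard (hps _ ht).1
    (f := e ∘ f) (e.injective.comp (hps _ ht).2) fun p hp => ?_
  exact hG _ _ (testBit_edgeMask (List.mem_map.2 ⟨p, hp, rfl⟩))

theorem edgeMask_cons (p : Fin 7 × Fin 7) (es : List (Fin 7 × Fin 7)) :
    edgeMask (p :: es) = pairMask p.1 p.2 ||| edgeMask es := rfl

theorem fits_edgeMask {G : SimpleGraph (Fin 7)} {es ns : List (Fin 7 × Fin 7)}
    (hE : ∀ p ∈ es, G.Adj p.1 p.2) (hN : ∀ p ∈ ns, ¬ G.Adj p.1 p.2) :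
    Fits G (edgeMask es) (edgeMask ns) := by
  have h0 : Fits G 0 0 := ⟨by simp, by simp⟩
  have hE' : Fits G (edgeMask es) 0 := by
    induction es with
    | nil => exact h0
    | cons p es ih =>
      rw [List.forall_mem_cons] at hE
      rw [edgeMask_cons, Nat.lor_comm]
      exact (ih hE.2).insert_adj hE.1
  induction ns with
  | nil => exact hE'
  | cons p ns ih =>
    rw [List.forall_mem_cons] at hN
    rw [edgeMask_cons, Nat.lor_comm]
    exact (ih hN.2).insert_not_adj hN.1

/-- If a vertex `v` has only two neighbours `p` and `q`, then `p` and `q` are adjacent to the four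
other vertices but serve no non-adjacent pair of these. So the four vertices form a graph of
diameter at most two, which contains a star or a 4-cycle. With `p`, `q` and `v`, either of them
yields a subdivision of `K₃,₃`. -/
theorem containsSpanning_of_degree_two {D : OrientedGraph V} (hD : D.IsPushClique)
    [DecidableRel D.underlying.Adj] (hplanar : IsPlanar D.underlying)
    (hcard : Fintype.card V = 7) {v : V} (hv : D.underlying.degree v = 2) :
    ContainsSpanning H10 D.underlying ∨ ContainsSpanning H11 D.underlying ∨
      ContainsSpanning H12 D.underlying := by
  obtain ⟨e, rfl, he⟩ := exists_labelling hcard (v := v) (s := D.underlying.neighborFinset v)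
    (by simp)
  rw [SimpleGraph.card_neighborFinset_eq_degree, hv] at he
  simp only [SimpleGraph.mem_neighborFinset] at he
  have h01 : D.underlying.Adj (e 0) (e 1) := (he 1).2 (by decide)
  have h02 : D.underlying.Adj (e 0) (e 2) := (he 2).2 (by decide)
  have h0 : ∀ w, D.underlying.Adj (e 0) w → w = e 1 ∨ w = e 2 := by
    intro w hw
    obtain ⟨i, rfl⟩ := e.surjective w
    have := (he i).1 hw
    simp only [e.injective.eq_iff]
    omega
  have h0' : ∀ i : Fin 7, 3 ≤ i → ¬ D.underlying.Adj (e 0) (e i) := by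
    intro i hi h
    have := (he i).1 h
    omega
  have hx : ∀ i : Fin 7, 3 ≤ i → _ := fun i hi => hD.arc_iff_of_two_neighbors h01 h02 h0
    (e.injective.ne (show i ≠ 0 by omega)) (h0' i hi)
  have h2 : ∀ i j : Fin 7, 3 ≤ i → 3 ≤ j → i ≠ j → ¬ D.underlying.Adj (e i) (e j) →
      ∃ k : Fin 7, 3 ≤ k ∧ D.underlying.Adj (e i) (e k) ∧ D.underlying.Adj (e k) (e j) := by
    intro i j hi hj hij hadj
    -- The vertex `0` is adjacent to neither end, so all common neighbours would be `1` or `2`.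
    by_contra! hno
    have hno' : ∀ w, D.underlying.Adj (e i) w → D.underlying.Adj (e j) w → w = e 1 ∨ w = e 2 := by
      intro w hiw hjw
      obtain ⟨k, rfl⟩ := e.surjective w
      have h3 : ¬ 3 ≤ k := fun hk => hno k hk hiw hjw.symm
      have hk0 : k ≠ 0 := by
        rintro rfl
        exact h0' i hi hiw.symm
      simp only [e.injective.eq_iff]
      omega
    obtain ⟨⟨y, hy⟩, ⟨z, hz⟩⟩ := hD.common_neighbors (e.injective.ne hij) hadj
    obtain ⟨hpi, hqi, hi'⟩ := hx i hi
    obtain ⟨hpj, hqj, hj'⟩ := hx j hj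
    refine OrientedGraph.not_mixed_of_arc_iff hpi hqi hpj hqj (hi'.trans hj'.symm)
      (hno' y ?_ ?_) (hno' z ?_ ?_) hy hz <;> simp only [OrientedGraph.underlying] <;> tauto
  by_contra hgoal
  have star : ∀ c x y z : Fin 7, Function.Injective ![1, 2, c, x, y, z, 0] →
      (3 ≤ x ∧ 3 ≤ y ∧ 3 ≤ z) → ¬ (D.underlying.Adj (e c) (e x) ∧ D.underlying.Adj (e c) (e y) ∧
        D.underlying.Adj (e c) (e z)) := by
    rintro c x y z hinj ⟨hx3, hy3, hz3⟩ hadj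
    refine hgoal (containsSpanning_of_pattern hplanar hcard (es := (0, 3) :: edgesK33) (by decide)
      (e.injective.comp hinj) ?_)
    simpa [edgesK33, hx x hx3, hx y hy3, hx z hz3] using hadj
  have cycle : ∀ x y z w : Fin 7, Function.Injective ![1, x, z, 2, y, w, 0] →
      (3 ≤ x ∧ 3 ≤ y ∧ 3 ≤ z ∧ 3 ≤ w) → ¬ (D.underlying.Adj (e x) (e y) ∧
        D.underlying.Adj (e y) (e z) ∧ D.underlying.Adj (e z) (e w) ∧
          D.underlying.Adj (e w) (e x)) := by
    rintro x y z w hinj ⟨hx3, hy3, hz3, hw3⟩ hadj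
    refine hgoal (containsSpanning_of_pattern hplanar hcard
      (es := (0, 6) :: (6, 3) :: edgesK33) (by decide) (e.injective.comp hinj) ?_)
    simp [edgesK33, hx y hy3, hx w hw3, h01.symm, h02, hadj, hadj.2.1.symm,
      (hx x hx3).2.1.symm, (hx z hz3).2.1.symm, hadj.2.2.2.symm]
  have s3 := star 3 4 5 6 (by decide) (by decide)
  have s4 := star 4 3 5 6 (by decide) (by decide)
  have s5 := star 5 3 4 6 (by decide) (by decide)
  have s6 := star 6 3 4 5 (by decide) (by decide)
  have c1 := cycle 3 4 5 6 (by decide) (by decide)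
  have c2 := cycle 3 4 6 5 (by decide) (by decide)
  have c3 := cycle 3 5 4 6 (by decide) (by decide)
  have key : ∀ i j : Fin 7, 3 ≤ i → 3 ≤ j → i ≠ j → D.underlying.Adj (e i) (e j) ∨
      D.underlying.Adj (e i) (e 3) ∧ D.underlying.Adj (e 3) (e j) ∨
      D.underlying.Adj (e i) (e 4) ∧ D.underlying.Adj (e 4) (e j) ∨
      D.underlying.Adj (e i) (e 5) ∧ D.underlying.Adj (e 5) (e j) ∨
      D.underlying.Adj (e i) (e 6) ∧ D.underlying.Adj (e 6) (e j) := by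
    intro i j hi hj hij
    by_cases hadj : D.underlying.Adj (e i) (e j)
    · exact Or.inl hadj
    · obtain ⟨k, hk, hkij⟩ := h2 i j hi hj hij hadj
      have : k = 3 ∨ k = 4 ∨ k = 5 ∨ k = 6 := by omega
      rcases this with rfl | rfl | rfl | rfl <;> simp [hkij]
  have p1 := key 3 4 (by decide) (by decide) (by decide)
  have p2 := key 3 5 (by decide) (by decide) (by decide)
  have p3 := key 3 6 (by decide) (by decide) (by decide)
  have p4 := key 4 5 (by decide) (by decide) (by decide)
  have p5 := key 4 6 (by decide) (by decide) (by decide)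
  have p6 := key 5 6 (by decide) (by decide) (by decide)
  have symm : ∀ i j : Fin 7, D.underlying.Adj (e i) (e j) = D.underlying.Adj (e j) (e i) :=
    fun i j => propext (D.underlying.adj_comm _ _)
  clear hx h2 key star cycle he h0 h0'
  simp only [SimpleGraph.irrefl, false_and, and_false, or_false, false_or, symm 4 3, symm 5 3,
    symm 6 3, symm 5 4, symm 6 4, symm 6 5] at s3 s4 s5 s6 c1 c2 c3 p1 p2 p3 p4 p5 p6
  grind

end PushClique

theorem lemma1 {V : Type*} [Fintype V] (G : SimpleGraph V)
    (hplanar : PushClique.IsPlanar G) (hG : PushClique.IsUnderlyingPushClique G)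
    (hcard : Fintype.card V = 7) :
    PushClique.ContainsSpanning PushClique.H10 G ∨
      PushClique.ContainsSpanning PushClique.H11 G ∨
        PushClique.ContainsSpanning PushClique.H12 G := by
  classical
  open PushClique in
  obtain ⟨D, rfl, hD⟩ := hG
  have hc := fun u v huv hadj => hD.exists_two_common (u := u) (v := v) huv hadj
  have : Nonempty V := Fintype.card_pos_iff.1 (by omega)
  obtain ⟨v, hv⟩ := Finite.exists_min fun v => D.underlying.degree v
  have hdeg : 2 ≤ D.underlying.degree v := by
    by_contra hlt
    have hcl : (insert v (D.underlying.neighborFinset v)).card < 7 :=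
      (Finset.card_insert_le _ _).trans_lt (by
        rw [SimpleGraph.card_neighborFinset_eq_degree]; omega)
    obtain ⟨u, hu⟩ : ∃ u, u ∉ insert v (D.underlying.neighborFinset v) := by
      by_contra! h
      rw [Finset.eq_univ_iff_forall.2 h, Finset.card_univ] at hcl
      omega
    simp only [Finset.mem_insert, SimpleGraph.mem_neighborFinset, not_or] at hu
    obtain ⟨x, y, hxy, hx, hy⟩ := hc v u (Ne.symm hu.1) hu.2
    have := Finset.card_le_card (show {x, y} ⊆ D.underlying.neighborFinset v by
      simp [Finset.insert_subset_iff, hx.1, hy.1])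
    rw [Finset.card_pair hxy, SimpleGraph.card_neighborFinset_eq_degree] at this
    omega
  rcases hdeg.eq_or_lt with h2 | h2
  · exact containsSpanning_of_degree_two hD hplanar hcard h2.symm
  rcases (Nat.succ_le_of_lt h2).eq_or_lt with h3 | h3
  · obtain ⟨e, rfl, he⟩ := exists_labelling hcard (v := v) (s := D.underlying.neighborFinset v)
      (by simp)
    rw [SimpleGraph.card_neighborFinset_eq_degree, ← h3] at he
    simp only [SimpleGraph.mem_neighborFinset] at he
    refine containsSpanning_of_search hplanar hcard e (k := 3) (fun w => h3.trans_le (hv w)) hc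
      placements3_valid (fits_edgeMask ?_ ?_) search_placements3
    · simp [he]
    · simp [he]
  · obtain ⟨s, hs, hs4⟩ := Finset.exists_subset_card_eq
      (show 4 ≤ (D.underlying.neighborFinset v).card from h3)
    obtain ⟨e, rfl, he⟩ := exists_labelling hcard (v := v) (s := s)
      (fun h => by simpa using hs h)
    have he' : ∀ i : Fin 7, 1 ≤ (i : ℕ) ∧ (i : ℕ) ≤ 4 → D.underlying.Adj (e 0) (e i) :=
      fun i hi => (SimpleGraph.mem_neighborFinset _ _ _).1 (hs ((he i).2 (hs4 ▸ hi)))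
    refine containsSpanning_of_search hplanar hcard e (k := 4)
      (fun w => (Nat.succ_le_of_lt h3).trans (hv w)) hc
      placements4_valid (fits_edgeMask ?_ ?_) search_placements4
    · simp [he']
    · simp
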